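/- Let $K$ be a field, let $\sigma$ be an automorphism of $K$ of finite order $n$ with fixed field $F$, and let $R=K[t;\sigma]$ be the twisted polynomial ring, in which $ta=\sigma(a)t$ for $a\in K$. Let $f\in R$ have degree $m\geq 1$ and satisfy $(f,t)_r=1$, i.e. $1$ is a greatest common right divisor of $f$ and $t$. Let $h(t)=\hat h(t^n)$, with $\hat h\in F[x]$ monic, be the minimal central left multiple of $f$: the element of minimal degree among the nonzero elements of the center of $R$ that have the form $gf$ with $g\in R$. Assume that $\hat h$ is irreducible in $F[x]$. Call $f$ a generalised A-polynomial if its eigenring $\mathcal{E}(f)=\{g\in R : fg\in Rf\}/Rf$ is a (finite-dimensional) central simple algebra over $F$. Then the following are equivalent: 1. $f$ is a generalised A-polynomial in $R$; 2. $\hat h(x)=x-a$ for some $a\in F$; 3. $f$ right divides $t^n-a$ in $R$ for some $a\in F$, i.e. $t^n-a=gf$ for some $g\in R$. Moreover, the constants in (2) and (3) agree: for every $a\in F$, $\hat h(x)=x-a$ if and only if $f$ right divides $t^n-a$ in $R$. -/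

import Mathlib

noncomputable section

universe u

/-- The action of `ℕ` on the field `K` by the powers of the automorphism `σ`. -/
@[reducible]
def sigmaAction {K : Type u} [Field K] (σ : K ≃+* K) :
    MulSemiringAction (Multiplicative ℕ) K :=
  MulSemiringAction.compHom K (powersHom (K ≃+* K) σ)

/-- The twisted polynomial ring `K[t;σ]`: skew polynomials `∑ aᵢ tⁱ` with coefficients on the
left, multiplied by the rule `t a = σ(a) t` (see `TwistedPolynomial.t_mul_C`). -/
def TwistedPolynomial {K : Type u} [Field K] (_σ : K ≃+* K) : Type u :=
  SkewPolynomial K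

/-- The fixed field `F = Fix(σ)`. -/
abbrev fixedSubfield {K : Type u} [Field K] (σ : K ≃+* K) : Subfield K :=
  RingHom.eqLocusField (σ : K →+* K) (RingHom.id K)

namespace TwistedPolynomial

variable {K : Type u} [Field K] {σ : K ≃+* K}

instance : Ring (TwistedPolynomial σ) :=
  letI := sigmaAction σ
  inferInstanceAs (Ring (SkewPolynomial K))

/-- The embedding of `K` in `K[t;σ]` as constant polynomials. -/
def C : K →+* TwistedPolynomial σ :=
  letI := sigmaAction σ
  SkewPolynomial.CRingHom

/-- The indeterminate `t`. -/
def t : TwistedPolynomial σ :=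
  (SkewPolynomial.X : SkewPolynomial K)

/-- The degree, with `deg 0 = ⊥`. -/
def degree (f : TwistedPolynomial σ) : WithBot ℕ :=
  (SkewPolynomial.support (R := K) f).max

/-- The defining relation of `K[t;σ]`. -/
theorem t_mul_C (a : K) : (t : TwistedPolynomial σ) * C a = C (σ a) * t := by
  let _ := sigmaAction σ
  have h1 : (SkewPolynomial.X : SkewPolynomial K) * SkewPolynomial.C a
      = SkewPolynomial.monomial 1 (σ a) := by
    rw [SkewPolynomial.X, ← SkewPolynomial.monomial_zero_left,
      SkewPolynomial.monomial_mul_monomial]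
    simp only [add_zero, Function.iterate_one, one_mul]
    rfl
  have h2 : SkewPolynomial.C (σ a) * (SkewPolynomial.X : SkewPolynomial K)
      = SkewPolynomial.monomial 1 (σ a) := SkewPolynomial.C_mul_X_eq_monomial
  exact h1.trans h2.symm

/-- The constants from the fixed field are central. -/
theorem C_comm (a : fixedSubfield σ) (f : TwistedPolynomial σ) :
    C (a : K) * f = f * C (a : K) := by
  let _ := sigmaAction σ
  have ha : ∀ k : ℕ, (SkewPolynomial.φ (R := K))^[k] (a : K) = a := fun k =>
    Function.iterate_fixed (f := SkewPolynomial.φ (R := K)) a.2 k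
  have key : ∀ p : SkewPolynomial K,
      SkewPolynomial.C (a : K) * p = p * SkewPolynomial.C (a : K) := fun p => by
    induction p using SkewPolynomial.induction with
    | h0 => rw [mul_zero, zero_mul]
    | ha k r q _ _ ih =>
      rw [mul_add, add_mul, ih, SkewPolynomial.C_mul_monomial, SkewPolynomial.monomial_mul_C, ha,
        mul_comm]
  exact key f

/-- `K[t;σ]` is an algebra over the fixed field `F` of `σ`. -/
instance : Algebra (fixedSubfield σ) (TwistedPolynomial σ) :=
  RingHom.toAlgebra' (C.comp (fixedSubfield σ).subtype) C_comm

/-- `f` right divides `h`: `h = g f` for some `g`. -/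
def RightDvd (f h : TwistedPolynomial σ) : Prop :=
  ∃ g : TwistedPolynomial σ, h = g * f

/-- `d` is a greatest common right divisor of `f` and `g`. -/
def IsGCRD (f g d : TwistedPolynomial σ) : Prop :=
  RightDvd d f ∧ RightDvd d g ∧
    ∀ e : TwistedPolynomial σ, RightDvd e f → RightDvd e g → RightDvd e d

/-- `h` is the minimal central left multiple of `f`, where `h(t) = ĥ(tⁿ)` with `ĥ ∈ F[x]` monic:
`h` has minimal degree among the nonzero central left multiples of `f`. -/
structure IsMinimalCentralLeftMultiple (n : ℕ) (f h : TwistedPolynomial σ)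
    (hhat : Polynomial (fixedSubfield σ)) : Prop where
  central : h ∈ Subring.center (TwistedPolynomial σ)
  rightDvd : RightDvd f h
  monic : hhat.Monic
  eq_aeval : h = Polynomial.aeval (t ^ n) hhat
  minimal : ∀ h' ∈ Subring.center (TwistedPolynomial σ), h' ≠ 0 → RightDvd f h' →
    h.degree ≤ h'.degree

/-- The left idealiser `I(f) = {g | f g ∈ R f}` of `f` in `R = K[t;σ]`; `Ideal.span {f}` is the
left ideal `R f`. -/
def idealiser (f : TwistedPolynomial σ) :
    Subalgebra (fixedSubfield σ) (TwistedPolynomial σ) where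
  carrier := {g | f * g ∈ Ideal.span {f}}
  mul_mem' {a b} ha hb := by
    obtain ⟨c, hc⟩ := Ideal.mem_span_singleton'.1 ha
    change f * (a * b) ∈ Ideal.span {f}
    rw [← mul_assoc, ← hc, mul_assoc]
    exact Ideal.mul_mem_left _ c hb
  add_mem' {a b} ha hb := by
    change f * (a + b) ∈ Ideal.span {f}
    rw [mul_add]
    exact Ideal.add_mem _ ha hb
  algebraMap_mem' a := by
    change f * algebraMap _ _ a ∈ Ideal.span {f}
    rw [← Algebra.commutes]
    exact Ideal.mul_mem_left _ _ (Ideal.mem_span_singleton_self f)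

/-- The left ideal `R f`, regarded as an ideal of the idealiser `I(f)`. -/
def idealiserIdeal (f : TwistedPolynomial σ) : Ideal (idealiser f) :=
  (Ideal.span {f}).comap (idealiser f).val

instance (f : TwistedPolynomial σ) : (idealiserIdeal f).IsTwoSided where
  mul_mem_of_left {a} b ha := by
    change (a : TwistedPolynomial σ) ∈ Ideal.span {f} at ha
    obtain ⟨c, hc⟩ := Ideal.mem_span_singleton'.1 ha
    change (a : TwistedPolynomial σ) * (b : TwistedPolynomial σ) ∈ Ideal.span {f}
    rw [← hc, mul_assoc]
    exact Ideal.mul_mem_left _ c b.2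

/-- The eigenring `E(f) = I(f) / R f`, an algebra over `F`. -/
def Eigenring (f : TwistedPolynomial σ) : Type u :=
  idealiser f ⧸ idealiserIdeal f

instance (f : TwistedPolynomial σ) : Ring (Eigenring f) :=
  inferInstanceAs (Ring (idealiser f ⧸ idealiserIdeal f))

instance (f : TwistedPolynomial σ) : Algebra (fixedSubfield σ) (Eigenring f) :=
  inferInstanceAs (Algebra (fixedSubfield σ) (idealiser f ⧸ idealiserIdeal f))

/-- `f` is a generalised A-polynomial: `E(f)` is a (finite-dimensional) central simple algebra
over `F`. -/
structure IsGeneralisedAPolynomial (f : TwistedPolynomial σ) : Prop where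
  central : Algebra.IsCentral (fixedSubfield σ) (Eigenring f)
  simple : IsSimpleRing (Eigenring f)
  finite : FiniteDimensional (fixedSubfield σ) (Eigenring f)

end TwistedPolynomial

end

/-! Write `R = K[t;σ]`. Conditions (2) and (3) match by Bézout in `F[x]`: if `ĥ ≠ x - a`, the two
are coprime, so `f` cannot right divide both values at the central element `tⁿ` without dividing
`1`. For (1) ⇒ (3), the class of `tⁿ` is central in the eigenring, hence equals some `a ∈ F`.

The substance is (3) ⇒ (1). Coprimality to `t` forces `a ≠ 0`, so `A = R/R(tⁿ - a)` is a cyclic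
algebra: it is spanned over `K` by powers of a unit inducing `σ`, which makes it simple with centre
`F` (`IsSimpleRing.of_span_powers`, `exists_fixed_of_mem_center`). Being semisimple, `A` has an
idempotent `e` such that `Rf` is the set of `p` with `p̄e = 0`, and `g ↦ ḡe` identifies the
eigenring with `eAe`. Corners inherit simplicity (`IsSimpleRing.of_corner`) and have centre `Z(A)e`
(`IsSimpleRing.exists_mem_center_mul_eq`). -/

/-! ### Corners of simple rings -/

section Corner

variable {A E S : Type*} [Ring A] [Ring E] [Ring S]

/-- If `e ≠ 0` is idempotent in a simple ring `A`, every element commuting with the corner `eAe`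
and lying in it is of the form `z e` with `z` central in `A`. -/
theorem IsSimpleRing.exists_mem_center_mul_eq [IsSimpleRing A] {e : A} (he0 : e ≠ 0) {w : A}
    (hew : e * w = w) (hwe : w * e = w) (hw : ∀ a, w * (e * a * e) = e * a * e * w) :
    ∃ z ∈ Subring.center A, z * e = w := by
  -- If `w = z e` with `z` central, then `b' = b z` works for every `b`. Conversely, the witness
  -- `b'` for `b = 1` is the desired `z`.
  let J : TwoSidedIdeal A := TwoSidedIdeal.mk' {b | ∃ b', ∀ a, b' * a * e = b * a * w}
    ⟨0, fun a => by simp⟩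
    (fun {x y} ⟨x', hx⟩ ⟨y', hy⟩ => ⟨x' + y', fun a => by simp only [add_mul, hx, hy]⟩)
    (fun {x} ⟨x', hx⟩ => ⟨-x', fun a => by simp only [neg_mul, hx]⟩)
    (fun {x y} ⟨y', hy⟩ => ⟨x * y', fun a => by
      have := congrArg (x * ·) (hy a)
      simpa only [mul_assoc] using this⟩)
    (fun {x y} ⟨x', hx⟩ => ⟨x' * y, fun a => by
      have := hx (y * a)
      simpa only [mul_assoc] using this⟩)
  have heJ : e ∈ J := by
    refine (TwoSidedIdeal.mem_mk' _ _ _ _ _ _ _).2 ⟨w, fun a => ?_⟩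
    calc w * a * e = w * e * a * e := by rw [hwe]
      _ = w * (e * a * e) := by simp only [mul_assoc]
      _ = e * a * (e * w) := by rw [hw]; simp only [mul_assoc]
      _ = e * a * w := by rw [hew]
  obtain ⟨z, hz⟩ := (TwoSidedIdeal.mem_mk' _ _ _ _ _ _ _).1
    (IsSimpleRing.one_mem_of_ne_zero_mem J he0 heJ)
  have hze : z * e = w := by simpa using hz 1
  refine ⟨z, Subring.mem_center_iff.2 fun a => ?_, hze⟩
  -- The right annihilator of `(az - za)A` is a two-sided ideal; containing `e ≠ 0`, it contains
  -- `1`.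
  let J' : TwoSidedIdeal A := TwoSidedIdeal.mk' {b | ∀ c, (a * z - z * a) * c * b = 0}
    (fun c => by simp)
    (fun {x y} hx hy c => by rw [mul_add, hx, hy, add_zero])
    (fun {x} hx c => by rw [mul_neg, hx, neg_zero])
    (fun {x y} hy c => by
      have := hy (c * x)
      simpa only [mul_assoc] using this)
    (fun {x y} hx c => by rw [← mul_assoc, hx, zero_mul])
  have heJ' : e ∈ J' := by
    refine (TwoSidedIdeal.mem_mk' _ _ _ _ _ _ _).2 fun c => ?_
    have h1 := hz c
    have h2 := hz (a * c)
    calc (a * z - z * a) * c * e = a * (z * c * e) - z * (a * c) * e := by noncomm_ring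
      _ = 0 := by rw [h1, h2]; noncomm_ring
  have := (TwoSidedIdeal.mem_mk' _ _ _ _ _ _ _).1
    (IsSimpleRing.one_mem_of_ne_zero_mem J' he0 heJ') 1
  simpa [sub_eq_zero] using this

/-- A ring that is a quotient `π` of `S` and is identified, through `χ`, with the corner `eAe` of
a simple ring `A`, is simple. -/
theorem IsSimpleRing.of_corner [IsSimpleRing A] {e : A} (he0 : e ≠ 0)
    (π : S →+* E) (hπ : Function.Surjective π) (χ : S →+ A) (hχ1 : χ 1 = e)
    (hχmul : ∀ s s', χ (s * s') = χ s * χ s') (hker : ∀ s, χ s = 0 ↔ π s = 0)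
    (hrange : ∀ a, ∃ s, χ s = e * a * e) : IsSimpleRing E := by
  have hπ_congr {s s'} (h : χ s = χ s') : π s = π s' := by
    rw [← sub_eq_zero, ← map_sub, ← hker, map_sub, h, sub_self]
  have hel (s) : e * χ s = χ s := by rw [← hχ1, ← hχmul, one_mul]
  have her (s) : χ s * e = χ s := by rw [← hχ1, ← hχmul, mul_one]
  have : Nontrivial E := ⟨1, 0, fun h => he0 <| by
    rw [← hχ1]; exact (hker 1).2 (by rw [map_one, h])⟩
  refine .of_eq_bot_or_eq_top fun I => or_iff_not_imp_left.2 fun hI => ?_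
  obtain ⟨x, hxI, hx0 : x ≠ 0⟩ := SetLike.exists_of_lt (bot_lt_iff_ne_bot.mpr hI : ⊥ < I)
  obtain ⟨g, rfl⟩ := hπ x
  -- The extension of `I` to `A`: those `a` for which the corner part of every `p a q` represents an
  -- element of `I`. Quantifying over all representatives `s` avoids inverting `χ`.
  let J : TwoSidedIdeal A := TwoSidedIdeal.mk'
    {a | ∀ p q s, χ s = e * (p * a * q) * e → π s ∈ I}
    (fun p q s hs => by
      rw [(hker s).1 (by simpa using hs)]
      exact I.zero_mem)
    (fun {x y} hx hy p q s hs => by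
      obtain ⟨s₁, h₁⟩ := hrange (p * x * q)
      obtain ⟨s₂, h₂⟩ := hrange (p * y * q)
      rw [hπ_congr (s' := s₁ + s₂) (by rw [hs, map_add, h₁, h₂]; noncomm_ring), map_add]
      exact I.add_mem (hx p q s₁ h₁) (hy p q s₂ h₂))
    (fun {x} hx p q s hs => by
      have := hx p q (-s) (by rw [map_neg, hs]; noncomm_ring)
      rw [map_neg] at this
      simpa using I.neg_mem this)
    (fun {x y} hy p q s hs => hy (p * x) q s (by rw [hs]; noncomm_ring))
    (fun {x y} hx p q s hs => hx p (y * q) s (by rw [hs]; noncomm_ring))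
  have hgJ : χ g ∈ J := by
    refine (TwoSidedIdeal.mem_mk' _ _ _ _ _ _ _).2 fun p q s hs => ?_
    obtain ⟨s₁, h₁⟩ := hrange p
    obtain ⟨s₂, h₂⟩ := hrange q
    have : π s = π (s₁ * g * s₂) := hπ_congr <| by
      rw [hs, hχmul, hχmul, h₁, h₂]
      calc e * (p * χ g * q) * e = e * p * χ g * q * e := by noncomm_ring
        _ = e * p * (e * χ g * e) * q * e := by rw [hel, her]
        _ = e * p * e * χ g * (e * q * e) := by noncomm_ring
    rw [this, map_mul, map_mul]
    exact I.mul_mem_right _ _ (I.mul_mem_left _ _ hxI)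
  have h1 := (TwoSidedIdeal.mem_mk' _ _ _ _ _ _ _).1
    (IsSimpleRing.one_mem_of_ne_zero_mem J (fun h => hx0 ((hker g).1 h)) hgJ) 1 1 1
    (by rw [hχ1, mul_one, mul_one, mul_one]; simpa [hχ1] using (hel 1).symm)
  rw [map_one] at h1
  exact (I.one_mem_iff).1 h1

end Corner

/-! ### Rings generated by a field and a unit acting on it by an automorphism -/

section Crossed

variable {K A : Type*} [Field K] [Ring A] {σ : K ≃+* K} {C : K →+* A} {T : A}

theorem pow_mul_of_semiconj (hT : ∀ x, T * C x = C (σ x) * T) (i : ℕ) (x : K) :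
    T ^ i * C x = C ((σ ^ i) x) * T ^ i := by
  induction i generalizing x with
  | zero => simp
  | succ i ih =>
    rw [pow_succ, mul_assoc, hT, ← mul_assoc, ih, mul_assoc, pow_succ]
    rfl

/-- A two-sided ideal containing a sum of monomials with distinct twists contains each of the
monomials. -/
theorem TwoSidedIdeal.monomial_mem_of_sum_mem (hT : ∀ x, T * C x = C (σ x) * T)
    (J : TwoSidedIdeal A) (s : Finset ℕ) (hs : Set.InjOn (fun i => σ ^ i) s) (c : ℕ → K)
    (hc : ∑ i ∈ s, C (c i) * T ^ i ∈ J) : ∀ i ∈ s, C (c i) * T ^ i ∈ J := by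
  classical
  induction s using Finset.induction_on generalizing c with
  | empty => simp
  | insert j s hj ih =>
    have key : ∀ i ∈ s, C (c i) * T ^ i ∈ J := by
      intro i hi
      have hne : σ ^ i ≠ σ ^ j := fun h => hj <| by
        rwa [← hs (Finset.mem_insert_of_mem hi) (Finset.mem_insert_self j s) h]
      obtain ⟨x, hx⟩ : ∃ x, (σ ^ i) x ≠ (σ ^ j) x := by
        by_contra! h
        exact hne (RingEquiv.ext h)
      -- The twisted commutator with `x` kills the `j`-th term and rescales the `i`-th by a nonzero
      -- constant.
      have hmem : ∑ i ∈ s, C (c i * ((σ ^ i) x - (σ ^ j) x)) * T ^ i ∈ J := by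
        have h1 := J.sub_mem (J.mul_mem_right _ (C x) hc) (J.mul_mem_left (C ((σ ^ j) x)) _ hc)
        convert h1 using 1
        have h2 (i : ℕ) : C (c i) * T ^ i * C x - C ((σ ^ j) x) * (C (c i) * T ^ i) =
            C (c i * ((σ ^ i) x - (σ ^ j) x)) * T ^ i := by
          rw [mul_assoc, pow_mul_of_semiconj hT, ← mul_assoc, ← mul_assoc, ← sub_mul, ← map_mul,
            ← map_mul, ← map_sub, mul_sub, mul_comm ((σ ^ j) x)]
        rw [Finset.sum_mul, Finset.mul_sum, ← Finset.sum_sub_distrib, Finset.sum_insert hj]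
        simp only [h2, sub_self, mul_zero, map_zero, zero_mul, zero_add]
      have h3 := ih (hs.mono (by simp)) _ hmem i hi
      have h4 := J.mul_mem_left (C ((σ ^ i) x - (σ ^ j) x)⁻¹) _ h3
      rwa [← mul_assoc, ← map_mul, mul_comm (c i), ← mul_assoc,
        inv_mul_cancel₀ (sub_ne_zero.2 hx), one_mul] at h4
    intro i hi
    rcases Finset.mem_insert.1 hi with rfl | hi
    · have := J.sub_mem hc (sum_mem key)
      rwa [Finset.sum_insert hj, add_sub_cancel_right] at this
    · exact key i hi

variable {n : ℕ}

/-- The twists `σ ^ i` with `i < n` are distinct, so each monomial lies in `J`; one with nonzero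
coefficient would be a unit. -/
theorem TwoSidedIdeal.coeff_eq_zero_of_sum_mem (hT : ∀ x, T * C x = C (σ x) * T)
    (hσ : orderOf σ = n) (hTu : IsUnit T) {J : TwoSidedIdeal A} (hJ : J ≠ ⊤) {c : ℕ → K}
    (hc : ∑ i ∈ Finset.range n, C (c i) * T ^ i ∈ J) {i : ℕ} (hi : i < n) : c i = 0 := by
  have h := J.monomial_mem_of_sum_mem hT (Finset.range n) (fun a ha b hb hab => by
    rw [Finset.coe_range, Set.mem_Iio, ← hσ] at ha hb
    exact pow_injOn_Iio_orderOf ha hb hab) c hc i (Finset.mem_range.2 hi)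
  by_contra h0
  apply hJ
  rw [← J.one_mem_iff]
  obtain ⟨u, hu⟩ := hTu.pow i
  have h1 := J.mul_mem_right _ (↑u⁻¹) (J.mul_mem_left (C (c i)⁻¹) _ h)
  rwa [← mul_assoc, ← map_mul, inv_mul_cancel₀ h0, map_one, one_mul, ← hu, Units.mul_inv] at h1

/-- A nonzero ring spanned by `1, T, …, Tⁿ⁻¹` over a field on which the unit `T` acts by an
automorphism of order `n` is simple. -/
theorem IsSimpleRing.of_span_powers [Nontrivial A] (hT : ∀ x, T * C x = C (σ x) * T)
    (hσ : orderOf σ = n) (hTu : IsUnit T)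
    (hspan : ∀ x : A, ∃ c : ℕ → K, x = ∑ i ∈ Finset.range n, C (c i) * T ^ i) :
    IsSimpleRing A := by
  refine .of_eq_bot_or_eq_top fun J => or_iff_not_imp_right.2 fun hJ => ?_
  refine le_antisymm (fun x hx => ?_) bot_le
  obtain ⟨c, rfl⟩ := hspan x
  rw [TwoSidedIdeal.mem_bot]
  refine Finset.sum_eq_zero fun i hi => ?_
  rw [TwoSidedIdeal.coeff_eq_zero_of_sum_mem hT hσ hTu hJ hx (Finset.mem_range.1 hi), map_zero,
    zero_mul]

/-- The centre of such a ring is the fixed field. -/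
theorem exists_fixed_of_mem_center [Nontrivial A] (hT : ∀ x, T * C x = C (σ x) * T)
    (hn : 0 < n) (hσ : orderOf σ = n) (hTu : IsUnit T)
    (hspan : ∀ x : A, ∃ c : ℕ → K, x = ∑ i ∈ Finset.range n, C (c i) * T ^ i)
    {z : A} (hz : z ∈ Subring.center A) : ∃ x : K, σ x = x ∧ z = C x := by
  rw [Subring.mem_center_iff] at hz
  obtain ⟨c, rfl⟩ := hspan z
  have hbot : (⊥ : TwoSidedIdeal A) ≠ ⊤ := fun h =>
    one_ne_zero ((TwoSidedIdeal.mem_bot A).1 (h ▸ TwoSidedIdeal.mem_top A (x := (1 : A))))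
  -- Commuting with constants leaves only the term of index `0`; commuting with `T` then makes it
  -- fixed by `σ`.
  have hc (i : ℕ) (hi : i < n) (hi0 : i ≠ 0) : c i = 0 := by
    obtain ⟨x, hx⟩ : ∃ x, (σ ^ i) x ≠ x := by
      by_contra! h
      exact pow_ne_one_of_lt_orderOf hi0 (hσ ▸ hi) (RingEquiv.ext h)
    have h0 : ∑ i ∈ Finset.range n, C (c i * ((σ ^ i) x - x)) * T ^ i = 0 := by
      rw [← sub_eq_zero.2 (hz (C x)).symm, Finset.sum_mul, Finset.mul_sum,
        ← Finset.sum_sub_distrib]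
      refine Finset.sum_congr rfl fun i _ => ?_
      rw [mul_assoc (C (c i)), pow_mul_of_semiconj hT, ← mul_assoc, ← mul_assoc, ← sub_mul,
        ← map_mul, ← map_mul, ← map_sub, mul_sub, mul_comm x]
    have := TwoSidedIdeal.coeff_eq_zero_of_sum_mem hT hσ hTu hbot
      (c := fun i => c i * ((σ ^ i) x - x)) ((TwoSidedIdeal.mem_bot _).2 h0) hi
    exact (mul_eq_zero.1 this).resolve_right (sub_ne_zero.2 hx)
  have hsum : ∑ i ∈ Finset.range n, C (c i) * T ^ i = C (c 0) := by
    rw [Finset.sum_eq_single_of_mem 0 (Finset.mem_range.2 hn), pow_zero, mul_one]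
    intro i hi hi0
    rw [hc i (Finset.mem_range.1 hi) hi0, map_zero, zero_mul]
  refine ⟨c 0, ?_, hsum⟩
  rw [hsum] at hz
  have := hz T
  rw [hT] at this
  exact C.injective (hTu.mul_right_cancel this)

end Crossed

/-! ### Arithmetic of the twisted polynomial ring. -/

namespace TwistedPolynomial

variable {K : Type*} [Field K] {σ : K ≃+* K}

theorem monomial_eq_C_mul_t_pow (k : ℕ) (r : K) :
    (SkewPolynomial.monomial k r : SkewPolynomial K) = (C r * t ^ k : TwistedPolynomial σ) := by
  let _ := sigmaAction σ
  exact (SkewPolynomial.C_mul_X_pow_eq_monomial (R := K) (a := r) (n := k)).symm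

theorem induction_on {motive : TwistedPolynomial σ → Prop} (p : TwistedPolynomial σ)
    (zero : motive 0) (add : ∀ p q, motive p → motive q → motive (p + q))
    (monomial : ∀ r k, motive (C r * t ^ k)) : motive p := by
  let _ := sigmaAction σ
  refine SkewPolynomial.induction (R := K) (motive := motive) p zero fun k r q _ _ hq => ?_
  exact add _ _ (monomial_eq_C_mul_t_pow (σ := σ) k r ▸ monomial r k) hq

theorem degree_t : (t : TwistedPolynomial σ).degree = 1 := by
  rw [degree, t, SkewPolynomial.X, SkewPolynomial.support_monomial _ one_ne_zero]
  rfl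

/-- Degrees add: the top coefficient of `g f` is `g_N σ^N(f_M)`, a product of nonzero elements of a
field. -/
theorem not_rightDvd_one {f : TwistedPolynomial σ} (hf : 1 ≤ f.degree) : ¬ RightDvd f 1 := by
  rintro ⟨g, hg⟩
  let _ := sigmaAction σ
  let f' : SkewPolynomial K := f
  let g' : SkewPolynomial K := g
  have h1 : (1 : SkewPolynomial K) = g' * f' := hg
  have hf' : 1 ≤ f'.support.max := hf
  obtain ⟨M, hM⟩ : ∃ M : ℕ, f'.support.max = M := by
    refine Finset.max_of_nonempty (Finset.nonempty_iff_ne_empty.2 fun h => ?_)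
    rw [h, Finset.max_empty] at hf'
    exact absurd (le_bot_iff.1 hf') (WithBot.coe_ne_bot (a := 1))
  have hM1 : 1 ≤ M := by rw [hM] at hf'; exact_mod_cast hf'
  obtain ⟨N, hN⟩ : ∃ N : ℕ, g'.support.max = N := by
    refine Finset.max_of_nonempty (Finset.nonempty_iff_ne_empty.2 fun h => ?_)
    rw [SkewPolynomial.support_eq_empty.1 h, zero_mul] at h1
    exact one_ne_zero h1
  have hfM := SkewPolynomial.mem_support_iff.1 (Finset.mem_of_max hM)
  have hgN := SkewPolynomial.mem_support_iff.1 (Finset.mem_of_max hN)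
  have hcoeff : (g' * f').coeff (N + M) =
      g'.coeff N * (Multiplicative.ofAdd N • f'.coeff M) := by
    let S : Finset (Multiplicative ℕ × Multiplicative ℕ) :=
      (Finset.HasAntidiagonal.antidiagonal (N + M)).map
        (Equiv.prodCongr Multiplicative.ofAdd Multiplicative.ofAdd).toEmbedding
    refine (SkewMonoidAlgebra.coeff_mul_antidiagonal_of_finset g' f' (Multiplicative.ofAdd (N + M))
      S (fun {p} => ?_)).trans ?_
    · rw [Finset.mem_map_equiv, Finset.HasAntidiagonal.mem_antidiagonal]
      exact Iff.rfl
    rw [Finset.sum_map]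
    refine Finset.sum_eq_single_of_mem (N, M) (Finset.HasAntidiagonal.mem_antidiagonal.2 rfl) ?_
    rintro ⟨i, j⟩ hp hne
    rw [Finset.HasAntidiagonal.mem_antidiagonal] at hp
    change g'.coeff i * (Multiplicative.ofAdd i • f'.coeff j) = 0
    rcases lt_trichotomy N i with h | h | h
    · rw [SkewPolynomial.notMem_support_iff.1 (Finset.notMem_of_max_lt h hN), zero_mul]
    · exact absurd (Prod.ext h.symm (show j = M by simp only at hp; omega)) hne
    · rw [SkewPolynomial.notMem_support_iff.1 (Finset.notMem_of_max_lt
        (show M < j by simp only at hp; omega) hM), smul_zero, mul_zero]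
  have h0 : (1 : SkewPolynomial K).coeff (N + M) = 0 := by
    rw [SkewPolynomial.coeff_one, if_neg (by omega)]
  rw [h1, hcoeff] at h0
  have h2 := (mul_eq_zero.1 h0).resolve_left hgN
  exact hfM ((map_eq_zero (MulSemiringAction.toRingHom (Multiplicative ℕ) K _)).1 h2)

theorem t_pow_mul_C (k : ℕ) (x : K) :
    (t : TwistedPolynomial σ) ^ k * C x = C ((σ ^ k) x) * t ^ k :=
  pow_mul_of_semiconj t_mul_C k x

theorem t_pow_orderOf_comm {n : ℕ} (hσ : orderOf σ = n) (p : TwistedPolynomial σ) :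
    t ^ n * p = p * t ^ n := by
  induction p using induction_on with
  | zero => simp
  | add p q hp hq => rw [mul_add, add_mul, hp, hq]
  | monomial r k =>
    rw [← mul_assoc, t_pow_mul_C, ← hσ, pow_orderOf_eq_one, RingAut.one_apply, mul_assoc, mul_assoc,
      ← pow_add, ← pow_add, add_comm]

theorem t_pow_sub_C_comm {n : ℕ} (hσ : orderOf σ = n) (a : fixedSubfield σ)
    (p : TwistedPolynomial σ) :
    (t ^ n - C (a : K)) * p = p * (t ^ n - C (a : K)) := by
  rw [sub_mul, mul_sub, t_pow_orderOf_comm hσ, C_comm]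

theorem exists_t_pow_mul_eq_mul_t_pow (k : ℕ) (p : TwistedPolynomial σ) :
    ∃ q, t ^ k * p = q * t ^ k := by
  induction p using induction_on with
  | zero => exact ⟨0, by simp⟩
  | add p q hp hq =>
    obtain ⟨p', hp⟩ := hp
    obtain ⟨q', hq⟩ := hq
    exact ⟨p' + q', by rw [mul_add, add_mul, hp, hq]⟩
  | monomial r j =>
    exact ⟨C ((σ ^ k) r) * t ^ j, by
      rw [← mul_assoc, t_pow_mul_C, mul_assoc, mul_assoc, ← pow_add, ← pow_add, add_comm]⟩

theorem exists_eq_mul_t_add_C (f : TwistedPolynomial σ) : ∃ g c, f = g * t + C c := by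
  induction f using induction_on with
  | zero => exact ⟨0, 0, by simp⟩
  | add p q hp hq =>
    obtain ⟨p', c, rfl⟩ := hp
    obtain ⟨q', d, rfl⟩ := hq
    exact ⟨p' + q', c + d, by rw [map_add]; noncomm_ring⟩
  | monomial r k =>
    rcases k with _ | k
    · exact ⟨0, r, by simp⟩
    · exact ⟨C r * t ^ k, 0, by simp [pow_succ, mul_assoc]⟩

/-- A nonconstant polynomial right coprime to `t` divides no power of `t`. -/
theorem not_rightDvd_t_pow {f : TwistedPolynomial σ} (hf : 1 ≤ f.degree) (hgcrd : IsGCRD f t 1)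
    (k : ℕ) : ¬ RightDvd f (t ^ k) := by
  induction k with
  | zero => rw [pow_zero]; exact not_rightDvd_one hf
  | succ k ih =>
    rintro ⟨g, hg⟩
    apply ih
    obtain ⟨f', c, hc⟩ := exists_eq_mul_t_add_C f
    have hc0 : c ≠ 0 := by
      rintro rfl
      exact not_rightDvd_one (σ := σ) degree_t.ge
        (hgcrd.2.2 t ⟨f', by rw [hc, map_zero, add_zero]⟩ ⟨1, (one_mul t).symm⟩)
    -- Since `f = f' t + c` with `c ≠ 0`, `1` lies in `Rf + Rt`. Multiplying by `t ^ k` on the left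
    -- and moving it past `c⁻¹ f'` puts `t ^ k` in `Rf + R t ^ (k + 1) = Rf`.
    obtain ⟨v, hv⟩ := exists_t_pow_mul_eq_mul_t_pow k (C c⁻¹ * f')
    refine ⟨t ^ k * C c⁻¹ - v * g, ?_⟩
    have hone : (1 : TwistedPolynomial σ) = C c⁻¹ * f - C c⁻¹ * f' * t := by
      have : C c⁻¹ * C c = (1 : TwistedPolynomial σ) := by
        rw [← map_mul, inv_mul_cancel₀ hc0, map_one]
      rw [← this, hc]
      noncomm_ring
    calc (t : TwistedPolynomial σ) ^ k = t ^ k * 1 := (mul_one _).symm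
      _ = t ^ k * C c⁻¹ * f - t ^ k * (C c⁻¹ * f') * t := by rw [hone]; noncomm_ring
      _ = t ^ k * C c⁻¹ * f - v * t ^ (k + 1) := by rw [hv, pow_succ, mul_assoc v]
      _ = (t ^ k * C c⁻¹ - v * g) * f := by rw [hg]; noncomm_ring

/-- Artin's theorem for the finite group generated by `σ`. -/
theorem finiteDimensional_fixedSubfield {n : ℕ} (hn : 0 < n) (hσ : orderOf σ = n) :
    FiniteDimensional (fixedSubfield σ) K := by
  have : Finite (Subgroup.zpowers σ) :=
    (isOfFinOrder_iff_pow_eq_one.2 ⟨n, hn, hσ ▸ pow_orderOf_eq_one σ⟩).finite_zpowers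
  have hfix : fixedSubfield σ = FixedPoints.subfield (Subgroup.zpowers σ) K := by
    ext x
    refine ⟨fun hx => ?_, fun hx => hx ⟨σ, Subgroup.mem_zpowers σ⟩⟩
    have h : σ ∈ MulAction.stabilizer (K ≃+* K) x := hx
    exact fun g => (Subgroup.zpowers_le.2 h) g.2
  rw [hfix]
  infer_instance

end TwistedPolynomial

/-! ### The eigenring and the quotient by `tⁿ - a`. -/

namespace TwistedPolynomial

variable {K : Type*} [Field K] {σ : K ≃+* K}

theorem isTwoSided_span_t_pow_sub_C {n : ℕ} (hσ : orderOf σ = n) (a : fixedSubfield σ) :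
    (Ideal.span {(t ^ n - C (a : K) : TwistedPolynomial σ)}).IsTwoSided where
  mul_mem_of_left {x} b hx := by
    obtain ⟨c, rfl⟩ := Ideal.mem_span_singleton'.1 hx
    rw [mul_assoc, t_pow_sub_C_comm hσ, ← mul_assoc]
    exact Ideal.mul_mem_left _ _ (Ideal.mem_span_singleton_self _)

theorem exists_map_eq_sum {A : Type*} [Ring A] (ψ : TwistedPolynomial σ →+* A) {n : ℕ}
    (hn : 0 < n) {a : K} (ha : ψ (t ^ n) = ψ (C a)) (p : TwistedPolynomial σ) :
    ∃ c : ℕ → K, ψ p = ∑ i ∈ Finset.range n, ψ (C (c i)) * ψ t ^ i := by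
  induction p using induction_on with
  | zero => exact ⟨0, by simp⟩
  | add p q hp hq =>
    obtain ⟨c, hc⟩ := hp
    obtain ⟨d, hd⟩ := hq
    exact ⟨c + d, by simp only [map_add, hc, hd, Pi.add_apply, add_mul, Finset.sum_add_distrib]⟩
  | monomial r k =>
    -- Each full factor `t ^ n` of `t ^ k` contributes one `a`.
    refine ⟨Pi.single (k % n) (r * a ^ (k / n)), ?_⟩
    rw [Finset.sum_eq_single_of_mem (k % n) (Finset.mem_range.2 (Nat.mod_lt k hn)),
      Pi.single_eq_same]
    · conv_lhs => rw [← Nat.div_add_mod k n, pow_add, pow_mul]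
      rw [map_mul ψ, map_mul ψ, map_pow ψ, ha, map_pow ψ, map_mul C, map_mul ψ, map_pow C,
        map_pow ψ, mul_assoc]
    · intro i _ hi
      rw [Pi.single_eq_of_ne hi, map_zero, map_zero, zero_mul]

theorem rightDvd_iff_mem_span {f h : TwistedPolynomial σ} :
    RightDvd f h ↔ h ∈ Ideal.span {f} := by
  rw [Ideal.mem_span_singleton']
  exact exists_congr fun _ => eq_comm

theorem eigenring_mk_eq_zero_iff {f : TwistedPolynomial σ} (g : idealiser f) :
    Ideal.Quotient.mk (idealiserIdeal f) g = 0 ↔ (g : TwistedPolynomial σ) ∈ Ideal.span {f} :=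
  Ideal.Quotient.eq_zero_iff_mem

theorem isGeneralisedAPolynomial_of_rightDvd {n : ℕ} (hn : 0 < n) (hσ : orderOf σ = n)
    {f : TwistedPolynomial σ} (hf : 1 ≤ f.degree) (hgcrd : IsGCRD f t 1) (a : fixedSubfield σ)
    (hdvd : RightDvd f (t ^ n - C (a : K))) : IsGeneralisedAPolynomial f := by
  have ha0 : (a : K) ≠ 0 := by
    intro h
    rw [h, map_zero, sub_zero] at hdvd
    exact not_rightDvd_t_pow hf hgcrd n hdvd
  let I : Ideal (TwistedPolynomial σ) := Ideal.span {t ^ n - C (a : K)}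
  have : I.IsTwoSided := isTwoSided_span_t_pow_sub_C hσ a
  have hIf : I ≤ Ideal.span {f} :=
    (Ideal.span_singleton_le_iff_mem _).2 (rightDvd_iff_mem_span.1 hdvd)
  have h1f : (1 : TwistedPolynomial σ) ∉ Ideal.span {f} := fun h =>
    not_rightDvd_one hf (rightDvd_iff_mem_span.2 h)
  let A := TwistedPolynomial σ ⧸ I
  let q : TwistedPolynomial σ →+* A := Ideal.Quotient.mk I
  have hq : Function.Surjective q := Ideal.Quotient.mk_surjective
  have : Nontrivial A := Ideal.Quotient.nontrivial_iff.2 fun h =>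
    h1f (hIf (h ▸ Submodule.mem_top))
  have hqt : q (t ^ n) = q (C (a : K)) :=
    Ideal.Quotient.eq.2 (Ideal.mem_span_singleton_self _)
  have hT (x : K) : q t * (q.comp C) x = (q.comp C) (σ x) * q t := by
    simp only [RingHom.comp_apply, ← map_mul, t_mul_C]
  have hTu : IsUnit (q t) := by
    have : IsUnit (q t ^ n) := by
      rw [← map_pow, hqt]
      exact (isUnit_iff_ne_zero.2 ha0).map (q.comp C)
    exact (isUnit_pow_iff hn.ne').1 this
  have hspan (x : A) : ∃ c : ℕ → K, x = ∑ i ∈ Finset.range n, (q.comp C) (c i) * q t ^ i := by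
    obtain ⟨p, rfl⟩ := hq x
    exact exists_map_eq_sum q hn hqt p
  have : IsSimpleRing A := .of_span_powers hT hσ hTu hspan
  have := finiteDimensional_fixedSubfield hn hσ
  have hqC (c : fixedSubfield σ) (x : K) : q (C (c • x)) = c • q (C x) := by
    rw [Algebra.smul_def, map_mul C, map_mul q, Algebra.smul_def]
    rfl
  have : Module.Finite (fixedSubfield σ) A := by
    let L : (Fin n → K) →ₗ[fixedSubfield σ] A :=
      { toFun := fun c => ∑ i : Fin n, q (C (c i)) * q t ^ (i : ℕ)
        map_add' := fun c d => by
          simp only [Pi.add_apply, map_add, add_mul, Finset.sum_add_distrib]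
        map_smul' := fun r c => by
          simp only [Pi.smul_apply, hqC, smul_mul_assoc, Finset.smul_sum, RingHom.id_apply] }
    refine Module.Finite.of_surjective L fun x => ?_
    obtain ⟨c, hc⟩ := hspan x
    refine ⟨fun i => c i, ?_⟩
    rw [hc, Finset.sum_range]
    rfl
  have : IsArtinianRing A := .of_finite (fixedSubfield σ) A
  -- `A` is simple Artinian, hence semisimple, so the left ideal `A f̄` is `Aε` with `ε` idempotent;
  -- it is the left annihilator of `e = 1 - ε`.
  obtain ⟨ε, hε, hεspan⟩ := IsSemisimpleRing.ideal_eq_span_idempotent (Ideal.span {q f})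
  obtain ⟨u, hu⟩ : ∃ u, u * q f = ε := Ideal.mem_span_singleton'.1
    (hεspan ▸ Ideal.mem_span_singleton_self ε)
  obtain ⟨v, hv⟩ : ∃ v, v * ε = q f := Ideal.mem_span_singleton'.1
    (hεspan ▸ Ideal.mem_span_singleton_self (q f))
  let e : A := 1 - ε
  have hεe : ε * e = 0 := by simp only [e, mul_sub, mul_one, hε.eq, sub_self]
  have hee : e * e = e := hε.one_sub.eq
  have hmem (p : TwistedPolynomial σ) : p ∈ Ideal.span {f} ↔ q p * e = 0 := by
    constructor
    · intro h
      obtain ⟨c, rfl⟩ := Ideal.mem_span_singleton'.1 h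
      rw [map_mul, ← hv, mul_assoc, mul_assoc v, hεe, mul_zero, mul_zero]
    · intro h
      obtain ⟨u', rfl⟩ := hq u
      have h1 : q p = q (p * u' * f) := by
        rw [map_mul, map_mul, mul_assoc, hu]
        simpa only [e, mul_sub, mul_one, sub_eq_zero] using h
      have h2 := hIf (Ideal.Quotient.eq.1 h1)
      simpa using Ideal.add_mem _ h2
        (Ideal.mul_mem_left _ (p * u') (Ideal.mem_span_singleton_self f))
  have hidl (g : TwistedPolynomial σ) : g ∈ idealiser f ↔ ε * q g * e = 0 := by
    change f * g ∈ Ideal.span {f} ↔ _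
    rw [hmem, map_mul, ← hv]
    refine ⟨fun h => ?_, fun h => ?_⟩
    · rw [hv] at h
      rw [← hu, mul_assoc, mul_assoc, ← mul_assoc (q f), h, mul_zero]
    · rw [mul_assoc v, mul_assoc, h, mul_zero]
  have he0 : e ≠ 0 := fun h => h1f ((hmem 1).2 (by rw [h, mul_zero]))
  let π : idealiser f →+* Eigenring f := Ideal.Quotient.mk (idealiserIdeal f)
  have hπ : Function.Surjective π := Ideal.Quotient.mk_surjective
  -- By `hidl`, `g` lies in the idealiser exactly when `ḡe = eḡe`; this makes `χ` multiplicative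
  -- with image `eAe`.
  let χ : idealiser f →+ A :=
    (AddMonoidHom.mulRight e).comp
      (q.toAddMonoidHom.comp (idealiser f).val.toRingHom.toAddMonoidHom)
  have hχ (s : idealiser f) : χ s = q s * e := rfl
  have hχ1 : χ 1 = e := by rw [hχ, OneMemClass.coe_one, map_one, one_mul]
  have heχ (s : idealiser f) : e * (q s * e) = q s * e := by
    rw [← mul_assoc]
    simp only [e]
    rw [sub_mul 1 ε, one_mul, sub_mul, sub_eq_self]
    exact (hidl s).1 s.2
  have hχmul (s s' : idealiser f) : χ (s * s') = χ s * χ s' := by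
    rw [hχ, hχ, hχ, mul_assoc (q s), heχ, MulMemClass.coe_mul, map_mul, mul_assoc]
  have hker (s : idealiser f) : χ s = 0 ↔ π s = 0 := by
    rw [hχ, ← hmem]
    exact (eigenring_mk_eq_zero_iff s).symm
  have hrange (b : A) : ∃ s, χ s = e * b * e := by
    obtain ⟨p, hp⟩ := hq (e * b * e)
    refine ⟨⟨p, (hidl p).2 ?_⟩, ?_⟩
    · rw [hp, ← mul_assoc, ← mul_assoc, hεe, zero_mul, zero_mul, zero_mul]
    · rw [hχ, hp, mul_assoc, hee]
  have hπ_congr {s s'} (h : χ s = χ s') : π s = π s' := by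
    rw [← sub_eq_zero, ← map_sub, ← hker, map_sub, h, sub_self]
  have hχ_congr {s s'} (h : π s = π s') : χ s = χ s' := by
    rw [← sub_eq_zero, ← map_sub, hker, map_sub, h, sub_self]
  refine ⟨⟨?_⟩, .of_corner he0 π hπ χ hχ1 hχmul hker hrange, ?_⟩
  · intro x hx
    obtain ⟨s, rfl⟩ := hπ x
    obtain ⟨z, hz, hzs⟩ := IsSimpleRing.exists_mem_center_mul_eq (e := e) he0 (w := χ s)
      (heχ s) (by rw [hχ, mul_assoc, hee]) (fun b => by
        obtain ⟨s', h'⟩ := hrange b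
        rw [← h', ← hχmul, ← hχmul]
        refine hχ_congr ?_
        rw [map_mul, map_mul]
        exact (Subalgebra.mem_center_iff.1 hx (π s')).symm)
    obtain ⟨c, hc, rfl⟩ := exists_fixed_of_mem_center hT hn hσ hTu hspan hz
    refine Algebra.mem_bot.2 ⟨⟨c, hc⟩, ?_⟩
    have : algebraMap (fixedSubfield σ) (Eigenring f) ⟨c, hc⟩ =
      π (algebraMap (fixedSubfield σ) (idealiser f) ⟨c, hc⟩) := rfl
    rw [this]
    exact hπ_congr hzs
  · have hsec := Function.surjInv_eq hπ
    -- The embedding of the eigenring in `A` induced by `χ`; `hχ_congr` makes the chosen section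
    -- irrelevant.
    let Φ : Eigenring f →ₗ[fixedSubfield σ] A :=
      { toFun := fun x => χ (Function.surjInv hπ x)
        map_add' := fun x y => by
          rw [← map_add]
          exact hχ_congr (by rw [map_add, hsec, hsec, hsec])
        map_smul' := fun c x => by
          have h1 : χ (Function.surjInv hπ (c • x)) = χ (c • Function.surjInv hπ x) := by
            refine hχ_congr ?_
            rw [hsec]
            conv_lhs => rw [← hsec x]
            rfl
          rw [h1, hχ, hχ, RingHom.id_apply, ← smul_mul_assoc]
          rfl }
    refine Module.Finite.of_injective Φ fun x y hxy => ?_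
    rw [← hsec x, ← hsec y]
    exact hπ_congr hxy

theorem IsGeneralisedAPolynomial.exists_rightDvd {n : ℕ} (hσ : orderOf σ = n)
    {f : TwistedPolynomial σ} (hf : IsGeneralisedAPolynomial f) :
    ∃ a : fixedSubfield σ, RightDvd f (t ^ n - C (a : K)) := by
  let π : idealiser f →+* Eigenring f := Ideal.Quotient.mk (idealiserIdeal f)
  have hπ : Function.Surjective π := Ideal.Quotient.mk_surjective
  let s : idealiser f := ⟨t ^ n, by
    change f * t ^ n ∈ Ideal.span {f}
    rw [← t_pow_orderOf_comm hσ]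
    exact Ideal.mul_mem_left _ _ (Ideal.mem_span_singleton_self f)⟩
  have hs : π s ∈ Subalgebra.center (fixedSubfield σ) (Eigenring f) := by
    refine Subalgebra.mem_center_iff.2 fun x => ?_
    obtain ⟨g, rfl⟩ := hπ x
    rw [← map_mul, ← map_mul]
    exact congrArg π (Subtype.ext (t_pow_orderOf_comm hσ (g : TwistedPolynomial σ)).symm)
  obtain ⟨a, ha⟩ := Algebra.mem_bot.1 (hf.central.out hs)
  refine ⟨a, rightDvd_iff_mem_span.2 ?_⟩
  have h0 : π (s - algebraMap (fixedSubfield σ) (idealiser f) a) = 0 := by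
    rw [map_sub, ← ha, sub_eq_zero]
    rfl
  exact (eigenring_mk_eq_zero_iff _).1 h0

theorem IsMinimalCentralLeftMultiple.eq_X_sub_C_iff {n : ℕ} {f h : TwistedPolynomial σ}
    {hhat : Polynomial (fixedSubfield σ)} (hf : 1 ≤ f.degree)
    (hmin : IsMinimalCentralLeftMultiple n f h hhat) (hirr : Irreducible hhat)
    (a : fixedSubfield σ) :
    hhat = Polynomial.X - Polynomial.C a ↔ RightDvd f (t ^ n - C (a : K)) := by
  have hval : Polynomial.aeval (t ^ n : TwistedPolynomial σ) (Polynomial.X - Polynomial.C a) =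
      t ^ n - C (a : K) := by
    rw [map_sub, Polynomial.aeval_X, Polynomial.aeval_C]
    rfl
  constructor
  · rintro rfl
    rw [← hval, ← hmin.eq_aeval]
    exact hmin.rightDvd
  · intro hdvd
    by_contra hne
    have hcop : IsCoprime hhat (Polynomial.X - Polynomial.C a) :=
      hirr.coprime_iff_not_dvd.2 fun hd => hne <|
        Polynomial.eq_of_monic_of_associated hmin.monic (Polynomial.monic_X_sub_C a)
          (hirr.associated_of_dvd (Polynomial.irreducible_X_sub_C a) hd)
    obtain ⟨u, v, huv⟩ := hcop
    have h1 := congrArg (Polynomial.aeval (t ^ n : TwistedPolynomial σ)) huv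
    rw [map_add, map_mul, map_mul, map_one, hval, ← hmin.eq_aeval] at h1
    refine not_rightDvd_one hf (rightDvd_iff_mem_span.2 ?_)
    rw [← h1]
    exact Ideal.add_mem _ (Ideal.mul_mem_left _ _ (rightDvd_iff_mem_span.1 hmin.rightDvd))
      (Ideal.mul_mem_left _ _ (rightDvd_iff_mem_span.1 hdvd))

end TwistedPolynomial

theorem theorem5 {K : Type*} [Field K] (σ : K ≃+* K) (n : ℕ) (hn : 0 < n) (hσ : orderOf σ = n)
    (f : TwistedPolynomial σ) (hdeg : 1 ≤ f.degree)
    (hgcrd : TwistedPolynomial.IsGCRD f TwistedPolynomial.t 1)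
    (h : TwistedPolynomial σ) (hhat : Polynomial (fixedSubfield σ))
    (hmin : TwistedPolynomial.IsMinimalCentralLeftMultiple n f h hhat)
    (hirr : Irreducible hhat) :
    (TwistedPolynomial.IsGeneralisedAPolynomial f ↔
      ∃ a : fixedSubfield σ, hhat = Polynomial.X - Polynomial.C a) ∧
    ((∃ a : fixedSubfield σ, hhat = Polynomial.X - Polynomial.C a) ↔
      ∃ a : fixedSubfield σ,
        TwistedPolynomial.RightDvd f
          (TwistedPolynomial.t ^ n - TwistedPolynomial.C (a : K))) ∧
    (∀ a : fixedSubfield σ,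
      hhat = Polynomial.X - Polynomial.C a ↔
        TwistedPolynomial.RightDvd f
          (TwistedPolynomial.t ^ n - TwistedPolynomial.C (a : K))) := by
  have hconst := hmin.eq_X_sub_C_iff hdeg hirr
  refine ⟨⟨fun hf => ?_, fun ⟨a, ha⟩ => ?_⟩, exists_congr hconst, hconst⟩
  · obtain ⟨a, ha⟩ := hf.exists_rightDvd hσ
    exact ⟨a, (hconst a).2 ha⟩
  · exact TwistedPolynomial.isGeneralisedAPolynomial_of_rightDvd hn hσ hdeg hgcrd a
      ((hconst a).1 ha)
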